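/- Let $G$ be a countably infinite amenable group and let $(F_n)$ be a Følner sequence in $G$, that is, a sequence of non-empty finite subsets with $|KF_n \,\triangle\, F_n|/|F_n| \to 0$ for every non-empty finite $K\subset G$. A zero-dimensional $G$-system $(X,T)$ is a compact metrizable space $X$ that has a basis of clopen sets, with an action $T=(T^g)_{g\in G}$ of $G$ on $X$ by homeomorphisms. A factor map is a continuous equivariant surjection. The topological entropy of $(X,T)$ is $$h(X,T)=\sup_{\mathcal U}\lim_{n\to\infty}\frac1{|F_n|}\log N\Big(\bigvee_{g\in F_n}T^{g^{-1}}\mathcal U\Big)\in[0,\infty],$$ where $\mathcal U$ runs over the finite open covers of $X$ and $N(\cdot)$ is the minimal cardinality of a subcover (the limit exists and does not depend on the Følner sequence). Let $\pi:(X,T)\to(Y,S)$ be a factor map between zero-dimensional $G$-systems, and let $\mathcal H_0^\pi(X,Y)$ be the set of values $h(Z,R)\in[0,\infty]$ over all zero-dimensional $G$-systems $(Z,R)$ for which there are factor maps $\varphi:X\to Z$ and $\psi:Z\to Y$ with $\pi=\psi\circ\varphi$. Then $$\mathcal H_0^\pi(X,Y)=[h(Y,S),h(X,T)],$$ where the interval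 is taken in the extended real line $[-\infty,\infty]$. -/

import Mathlib

open Set Filter Topology
open scoped Pointwise symmDiff

universe u v w

/-- A (left) Følner sequence: nonempty finite sets `F n ⊆ G` such that
`|K F_n ∆ F_n| / |F_n| → 0` for every nonempty finite `K ⊆ G`. A countable group is amenable iff
it has one. -/
structure IsFolnerSeq {G : Type w} [Group G] (F : ℕ → Finset G) : Prop where
  nonempty : ∀ n, (F n).Nonempty
  tendsto : ∀ K : Finset G, K.Nonempty →
    Tendsto (fun n => (((((K : Set G) * (F n : Set G)) ∆ (F n : Set G)).ncard : ℕ) : ℝ) /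
      ((F n).card : ℝ)) atTop (𝓝 0)

/-- `X` with the given action is a zero-dimensional `G`-system: a compact metrizable space with a
basis of clopen sets, on which every element of `G` acts continuously (hence by a
homeomorphism). -/
structure IsZeroDimSystem (G : Type w) [Group G] (X : Type u) [TopologicalSpace X]
    [MulAction G X] : Prop where
  compact : CompactSpace X
  metrizable : TopologicalSpace.MetrizableSpace X
  continuous_smul : ∀ g : G, Continuous fun x : X => g • x
  clopen_basis : TopologicalSpace.IsTopologicalBasis {s : Set X | IsClopen s}

/-- A factor map of `G`-systems: a continuous equivariant surjection. -/
structure IsFactorMap (G : Type w) [Group G] {X : Type u} {Y : Type v}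
    [TopologicalSpace X] [TopologicalSpace Y] [MulAction G X] [MulAction G Y]
    (f : X → Y) : Prop where
  continuous : Continuous f
  surjective : Function.Surjective f
  map_smul : ∀ (g : G) (x : X), f (g • x) = g • f x

/-- `𝒰` is a finite open cover of `X`. -/
structure IsFiniteOpenCover {X : Type u} [TopologicalSpace X] (𝒰 : Set (Set X)) : Prop where
  finite : 𝒰.Finite
  isOpen : ∀ U ∈ 𝒰, IsOpen U
  covers : ⋃₀ 𝒰 = univ

/-- The join `⋁_{g ∈ E} g⁻¹ 𝒰`: its members are the sets `⋂_{g ∈ E} g⁻¹ U_g`, `U_g ∈ 𝒰`. -/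
def coverJoin {G : Type w} [Group G] {X : Type u} [MulAction G X]
    (𝒰 : Set (Set X)) (E : Finset G) : Set (Set X) :=
  {V | ∃ U : G → Set X, (∀ g ∈ E, U g ∈ 𝒰) ∧ V = ⋂ g ∈ E, (fun x : X => g • x) ⁻¹' U g}

/-- The minimal cardinality of a finite subfamily of `𝒱` that covers `X`. -/
noncomputable def coverNumber {X : Type u} (𝒱 : Set (Set X)) : ℕ :=
  sInf {n | ∃ 𝒲 : Finset (Set X), (𝒲 : Set (Set X)) ⊆ 𝒱 ∧
    ⋃₀ (𝒲 : Set (Set X)) = univ ∧ 𝒲.card = n}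

/-- The entropy of the action on `X` relative to the cover `𝒰`, along `F`:
`lim_n |F_n|⁻¹ log N(𝒰_{F_n})`. The limit exists for a Følner sequence and a finite open cover;
it is written as a `limsup`, which needs no existence proof. -/
noncomputable def entropyOfCover {G : Type w} [Group G] {X : Type u} [MulAction G X]
    (F : ℕ → Finset G) (𝒰 : Set (Set X)) : EReal :=
  limsup (fun n => ((Real.log (coverNumber (coverJoin 𝒰 (F n))) / ((F n).card : ℝ) : ℝ) : EReal))
    atTop

/-- Topological entropy (along the Følner sequence `F`) of the `G`-system `X`: the supremum of
the entropies relative to all finite open covers, an extended real number. -/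
noncomputable def topEntropy {G : Type w} [Group G] (F : ℕ → Finset G) (X : Type u)
    [TopologicalSpace X] [MulAction G X] : EReal :=
  ⨆ (𝒰 : Set (Set X)) (_ : IsFiniteOpenCover 𝒰), entropyOfCover F 𝒰

/-- The set of entropies of zero-dimensional intermediate factors of `π : X → Y`. Such a factor
is a quotient of `X`, so it is no restriction to take it in the universe of `X`. -/
def zeroDimIntermediateEntropies {G : Type w} [Group G] (F : ℕ → Finset G)
    {X : Type u} {Y : Type v} [TopologicalSpace X] [TopologicalSpace Y]
    [MulAction G X] [MulAction G Y] (π : X → Y) : Set EReal :=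
  {r | ∃ (Z : Type u) (_ : TopologicalSpace Z) (_ : MulAction G Z) (φ : X → Z) (ψ : Z → Y),
    IsZeroDimSystem G Z ∧ IsFactorMap G φ ∧ IsFactorMap G ψ ∧ π = ψ ∘ φ ∧
      topEntropy F Z = r}

/-! ### Elementary counting. -/

section Counting

variable {Ω : Type*} {α : Type*} {β : Type*}

/-! A zero-dimensional intermediate factor is encoded by an invariant family of clopen subsets of
`X` containing the pullbacks of the clopen subsets of `Y`; its fibres are the classes of points that
the family does not separate. The entropy of the factor is the supremum, over finite subfamilies, of
the growth rate of the number of itineraries (`topEntropy_eq_familyEntropy`). Hence entropy is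
monotone in the family, which gives one inclusion, and a bound on it passes to unions of chains.

For the other inclusion, Zorn's lemma gives a family that is maximal among those of entropy at most
`r`. If its entropy were less than `r ≤ h(X)`, it could not separate points, and
`exists_isClopen_familyEntropy_adjoin_le` would enlarge it by a clopen set at a cost below the gap.

That small step takes a small clopen neighbourhood `A` of a point `x`, omitting another point of the
class of `x`. If some point in a nontrivial class has a large orbit, `A` around it can be made so
rarely visited that its visit patterns are few, by an entropy bound for sparse subsets. Otherwise
orbits in nontrivial classes have bounded size, and `x` is chosen with the largest one, of size `m`.
Then `A` can be chosen so that each class shows at most `m + 1` visit patterns along a prescribed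
finite set `K⁻¹ K`. Covering by translates of this set makes the rate at most a constant times `log
(m + 1) / |K|`, which is small once `K` is large. -/

theorem ncard_range_le_of_factor (f : Ω → α) (g : Ω → β) (hg : (range g).Finite)
    (h : ∀ x y, g x = g y → f x = f y) : (range f).ncard ≤ (range g).ncard := by
  classical
  rcases isEmpty_or_nonempty Ω with hΩ | hΩ
  · simp [range_eq_empty]
  have hsub : range f ⊆ (fun b => f (Function.invFun g b)) '' range g := by
    rintro _ ⟨x, rfl⟩
    exact ⟨g x, mem_range_self x, h _ _ (Function.invFun_eq ⟨x, rfl⟩)⟩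
  exact (ncard_le_ncard hsub (hg.image _)).trans (ncard_image_le hg)

/-- Sum over the values of `g` the number of values of `f` on each fibre: a counting form of
bounding joint entropy by conditional entropy. -/
theorem ncard_range_prod_le (f : Ω → α) (g : Ω → β) (hf : (range f).Finite)
    (hg : (range g).Finite) (M : ℝ)
    (h : ∀ x, ((f '' {y | g y = g x}).ncard : ℝ) ≤ M) :
    ((range fun x => (f x, g x)).ncard : ℝ) ≤ (range g).ncard * M := by
  classical
  have hsub : range (fun x => (f x, g x)) ⊆
      ⋃ b ∈ hg.toFinset, (fun a => (a, b)) '' (f '' {y | g y = b}) := by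
    rintro _ ⟨x, rfl⟩
    simp only [mem_iUnion]
    exact ⟨g x, by simp, f x, ⟨x, rfl, rfl⟩, rfl⟩
  have hfin : ∀ b, (f '' {y | g y = b}).Finite := fun b => hf.subset (image_subset_range _ _)
  have h1 : (range fun x => (f x, g x)).ncard ≤
      ∑ b ∈ hg.toFinset, ((fun a => (a, b)) '' (f '' {y | g y = b})).ncard := by
    refine (ncard_le_ncard hsub ?_).trans (Finset.set_ncard_biUnion_le _ _)
    exact hg.toFinset.finite_toSet.biUnion fun b _ => (hfin b).image _
  have h2 : ∀ b ∈ hg.toFinset,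
      (((fun a => (a, b)) '' (f '' {y | g y = b})).ncard : ℝ) ≤ M := by
    intro b hb
    obtain ⟨x, rfl⟩ := hg.mem_toFinset.1 hb
    refine le_trans ?_ (h x)
    exact_mod_cast ncard_image_le (hfin _)
  calc ((range fun x => (f x, g x)).ncard : ℝ)
      ≤ ∑ b ∈ hg.toFinset, (((fun a => (a, b)) '' (f '' {y | g y = b})).ncard : ℝ) := by
        exact_mod_cast h1
    _ ≤ ∑ b ∈ hg.toFinset, M := Finset.sum_le_sum h2
    _ = (range g).ncard * M := by
        rw [Finset.sum_const, nsmul_eq_mul, ncard_eq_toFinset_card _ hg]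

theorem log_natCast_mono {a b : ℕ} (h : a ≤ b) : Real.log a ≤ Real.log b := by
  rcases Nat.eq_zero_or_pos a with rfl | ha
  · simpa using Real.log_natCast_nonneg b
  · exact Real.log_le_log (by exact_mod_cast ha) (by exact_mod_cast h)

/-- The number of subsets of `E` with at most `s` elements is at most `exp (|E| t + s log t⁻¹)`. -/
theorem card_small_subsets_le (E : Finset α) (s t : ℝ) (ht : 0 < t) (ht1 : t ≤ 1) :
    (({T : Set α | T ⊆ E ∧ (T.ncard : ℝ) ≤ s}.ncard : ℕ) : ℝ) ≤
      Real.exp (E.card * t + s * Real.log t⁻¹) := by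
  classical
  set 𝒯 : Finset (Finset α) := E.powerset.filter fun T => (T.card : ℝ) ≤ s
  have hsub : {T : Set α | T ⊆ E ∧ (T.ncard : ℝ) ≤ s} ⊆
      (fun T : Finset α => (T : Set α)) '' (𝒯 : Set (Finset α)) := by
    rintro T ⟨hT, hs⟩
    have hfin : T.Finite := E.finite_toSet.subset hT
    refine ⟨hfin.toFinset, ?_, by simp⟩
    rw [ncard_eq_toFinset_card T hfin] at hs
    simp only [𝒯, Finset.coe_filter, Finset.mem_powerset, mem_ofPred_eq]
    exact ⟨by intro a ha; exact hT (hfin.mem_toFinset.1 ha), hs⟩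
  have h1 : ({T : Set α | T ⊆ E ∧ (T.ncard : ℝ) ≤ s}.ncard : ℝ) ≤ 𝒯.card := by
    have := (ncard_le_ncard hsub (𝒯.finite_toSet.image _)).trans
      (ncard_image_le 𝒯.finite_toSet)
    rw [ncard_coe_finset] at this
    exact_mod_cast this
  -- Exponential weighting: a set of at most `s` elements has `t ^ |T| ≥ t ^ s`, while the weights
  -- of all subsets of `E` sum to `(1 + t) ^ |E|`.
  have h2 : ∀ T ∈ 𝒯, (1 : ℝ) ≤ Real.exp (s * Real.log t⁻¹) * t ^ T.card := by
    intro T hT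
    have hs : (T.card : ℝ) ≤ s := (Finset.mem_filter.1 hT).2
    have : t ^ T.card = Real.exp (-(T.card * Real.log t⁻¹)) := by
      rw [Real.log_inv, mul_neg, neg_neg, mul_comm, Real.exp_mul, Real.exp_log ht,
        Real.rpow_natCast]
    rw [this, ← Real.exp_add]
    refine Real.one_le_exp ?_
    have hl : 0 ≤ Real.log t⁻¹ := Real.log_nonneg ((one_le_inv₀ ht).2 ht1)
    nlinarith
  calc _ ≤ (𝒯.card : ℝ) := h1
    _ = ∑ T ∈ 𝒯, (1 : ℝ) := by simp
    _ ≤ ∑ T ∈ 𝒯, Real.exp (s * Real.log t⁻¹) * t ^ T.card := Finset.sum_le_sum h2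
    _ ≤ ∑ T ∈ E.powerset, Real.exp (s * Real.log t⁻¹) * t ^ T.card :=
        Finset.sum_le_sum_of_subset_of_nonneg (Finset.filter_subset _ _)
          fun _ _ _ => by positivity
    _ = Real.exp (s * Real.log t⁻¹) * (t + 1) ^ E.card := by
        rw [← Finset.mul_sum, ← Finset.sum_pow_mul_eq_add_pow]
        simp
    _ ≤ Real.exp (s * Real.log t⁻¹) * Real.exp t ^ E.card := by
        gcongr
        exact Real.add_one_le_exp t
    _ = _ := by
        rw [← Real.exp_nat_mul, ← Real.exp_add, add_comm]

end Counting

/-! ### Følner sequences and coverings by translates. -/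

section Folner

variable {G : Type w} [Group G]

theorem IsFolnerSeq.eventually_ncard_mul_le {F : ℕ → Finset G} (hF : IsFolnerSeq F)
    (K : Finset G) (hK : K.Nonempty) :
    ∀ᶠ n in atTop, ((((K : Set G) * (F n : Set G)).ncard : ℕ) : ℝ) ≤ 2 * (F n).card := by
  filter_upwards [(hF.tendsto K hK).eventually (gt_mem_nhds one_pos)] with n hn
  have hpos : (0 : ℝ) < (F n).card := by exact_mod_cast (hF.nonempty n).card_pos
  rw [div_lt_one hpos] at hn
  have hfin : ((K : Set G) * (F n : Set G)).Finite := K.finite_toSet.mul (F n).finite_toSet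
  have hsub : (K : Set G) * (F n : Set G) ⊆
      (((K : Set G) * (F n : Set G)) ∆ (F n : Set G)) ∪ (F n : Set G) := by
    intro a ha
    by_cases h : a ∈ (F n : Set G)
    · exact Or.inr h
    · exact Or.inl (Or.inl ⟨ha, h⟩)
  have hfin' : (((K : Set G) * (F n : Set G)) ∆ (F n : Set G)).Finite :=
    (hfin.union (F n).finite_toSet).subset symmDiff_subset_union
  have h1 := (ncard_le_ncard hsub (hfin'.union (F n).finite_toSet)).trans (ncard_union_le _ _)
  rw [ncard_coe_finset] at h1
  have h1' : ((((K : Set G) * (F n : Set G)).ncard : ℕ) : ℝ) ≤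
    ((((K : Set G) * (F n : Set G)) ∆ (F n : Set G)).ncard : ℕ) + (F n).card := by
    exact_mod_cast h1
  linarith

/-- A finite set `E` is covered by few right translates of `K⁻¹ K`. -/
theorem exists_translates_cover (K E : Set G) (hK : K.Finite) (hKn : K.Nonempty)
    (hE : E.Finite) :
    ∃ C : Finset G, (C : Set G) ⊆ E ∧ C.card * K.ncard ≤ (K * E).ncard ∧
      ∀ e ∈ E, ∃ c ∈ C, ∃ k ∈ K, ∃ k' ∈ K, e = k⁻¹ * k' * c := by
  classical
  lift K to Finset G using hK
  lift E to Finset G using hE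
  set 𝒞 : Finset (Finset G) := E.powerset.filter fun C =>
    (C : Set G).PairwiseDisjoint fun c => K.image (· * c)
  have h𝒞 : 𝒞.Nonempty := ⟨∅, by simp [𝒞]⟩
  -- Take as many centres as possible with disjoint translates `K c`. Disjointness inside `K E`
  -- bounds their number; maximality makes every `K e` meet some `K c`, so `e ∈ K⁻¹ K c`.
  obtain ⟨C, hC, hmax⟩ := 𝒞.exists_max_image Finset.card h𝒞
  obtain ⟨hCE, hdisj⟩ := Finset.mem_filter.1 hC
  rw [Finset.mem_powerset] at hCE
  have hcard : ∀ c : G, (K.image (· * c)).card = K.card := fun c =>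
    Finset.card_image_of_injective _ (mul_left_injective c)
  refine ⟨C, by exact_mod_cast hCE, ?_, ?_⟩
  · have : (C.biUnion fun c => K.image (· * c)).card = C.card * K.card := by
      rw [Finset.card_biUnion hdisj, Finset.sum_congr rfl fun c _ => hcard c]
      simp
    rw [ncard_coe_finset, ← this, ← Finset.coe_mul, ncard_coe_finset]
    refine Finset.card_le_card fun a ha => ?_
    simp only [Finset.mem_biUnion, Finset.mem_image] at ha
    obtain ⟨c, hc, k, hk, rfl⟩ := ha
    exact Finset.mul_mem_mul hk (hCE hc)
  · intro e he
    by_contra hcon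
    push Not at hcon
    have heC : e ∉ C := by
      intro heC
      obtain ⟨k, hk⟩ := hKn
      exact hcon e heC k hk k hk (by group)
    have : insert e C ∈ 𝒞 := by
      refine Finset.mem_filter.2 ⟨?_, ?_⟩
      · rw [Finset.mem_powerset, Finset.insert_subset_iff]
        exact ⟨by exact_mod_cast he, hCE⟩
      · rw [Finset.coe_insert]
        refine hdisj.insert fun c hc _ => ?_
        refine Finset.disjoint_left.2 ?_
        intro a ha ha'
        obtain ⟨k, hk, rfl⟩ := Finset.mem_image.1 ha
        obtain ⟨k', hk', hkk⟩ := Finset.mem_image.1 ha'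
        refine hcon c hc k hk k' hk' ?_
        rw [mul_assoc, hkk]; group
    have := hmax _ this
    rw [Finset.card_insert_of_notMem heC] at this
    omega

end Folner

/-! ### Itineraries and the entropy of a family of sets. -/

section Names

variable {G : Type w} [Group G] {X : Type u} [MulAction G X]

/-- `x` and `y` belong to the same members of the family `𝔅`. -/
def Indist (𝔅 : Set (Set X)) (x y : X) : Prop := ∀ B ∈ 𝔅, x ∈ B ↔ y ∈ B

theorem Indist.symm {𝔅 : Set (Set X)} {x y : X} (h : Indist 𝔅 x y) : Indist 𝔅 y x :=
  fun B hB => (h B hB).symm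

theorem Indist.trans {𝔅 : Set (Set X)} {x y z : X} (h : Indist 𝔅 x y) (h' : Indist 𝔅 y z) :
    Indist 𝔅 x z :=
  fun B hB => (h B hB).trans (h' B hB)

theorem Indist.mono {𝔅 𝔅' : Set (Set X)} (hsub : 𝔅 ⊆ 𝔅') {x y : X} (h : Indist 𝔅' x y) :
    Indist 𝔅 x y :=
  fun B hB => h B (hsub hB)

/-- The record of the visits of `g • x`, `g ∈ E`, to the members of `ℱ`. -/
def itinerary (ℱ : Set (Set X)) (E : Set G) (x : X) : Set (G × Set X) :=
  {p | p.1 ∈ E ∧ p.2 ∈ ℱ ∧ p.1 • x ∈ p.2}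

theorem itinerary_eq_iff {ℱ : Set (Set X)} {E : Set G} {x y : X} :
    itinerary ℱ E x = itinerary ℱ E y ↔ ∀ g ∈ E, Indist ℱ (g • x) (g • y) := by
  constructor
  · intro h g hg B hB
    have := Set.ext_iff.1 h (g, B)
    simpa [itinerary, hg, hB] using this
  · intro h
    ext ⟨g, B⟩
    simp only [itinerary, mem_ofPred_eq]
    constructor
    · rintro ⟨hg, hB, hx⟩
      exact ⟨hg, hB, (h g hg B hB).1 hx⟩
    · rintro ⟨hg, hB, hx⟩
      exact ⟨hg, hB, (h g hg B hB).2 hx⟩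

theorem finite_range_itinerary {ℱ : Set (Set X)} {E : Set G} (hℱ : ℱ.Finite) (hE : E.Finite) :
    (range (itinerary (X := X) ℱ E)).Finite := by
  refine (hE.prod hℱ).finite_subsets.subset ?_
  rintro _ ⟨x, rfl⟩ p ⟨h1, h2, _⟩
  exact ⟨h1, h2⟩

/-- The number of itineraries of points of `X` over `E`. -/
noncomputable def nameCount (ℱ : Set (Set X)) (E : Set G) : ℕ :=
  (range (itinerary (X := X) ℱ E)).ncard

/-- The elements of `E` that bring `x` into `A`. -/
def visits (A : Set X) (E : Set G) (x : X) : Set G := {g | g ∈ E ∧ g • x ∈ A}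

theorem finite_range_visits (A : Set X) {E : Set G} (hE : E.Finite) :
    (range (visits A E)).Finite := by
  refine hE.finite_subsets.subset ?_
  rintro _ ⟨x, rfl⟩ g hg
  exact hg.1

/-- The exponential growth rate of the number of itineraries, for finitely many sets. -/
noncomputable def nameEntropy (F : ℕ → Finset G) (ℱ : Set (Set X)) : EReal :=
  limsup (fun n => ((Real.log (nameCount ℱ (F n : Set G)) / ((F n).card : ℝ) : ℝ) : EReal)) atTop

/-- The entropy of a family of sets: the supremum over its finite subfamilies. -/
noncomputable def familyEntropy (F : ℕ → Finset G) (𝔅 : Set (Set X)) : EReal :=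
  ⨆ (ℱ : Finset (Set X)) (_ : (ℱ : Set (Set X)) ⊆ 𝔅), nameEntropy F (ℱ : Set (Set X))

theorem familyEntropy_mono (F : ℕ → Finset G) {𝔅 𝔅' : Set (Set X)} (h : 𝔅 ⊆ 𝔅') :
    familyEntropy F 𝔅 ≤ familyEntropy F 𝔅' :=
  iSup₂_le fun ℱ hℱ => le_iSup₂_of_le ℱ (hℱ.trans h) le_rfl

theorem familyEntropy_nonneg (F : ℕ → Finset G) (𝔅 : Set (Set X)) : 0 ≤ familyEntropy F 𝔅 := by
  refine le_iSup₂_of_le ∅ (by simp) ?_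
  refine le_limsup_of_frequently_le (Eventually.frequently (Eventually.of_forall fun n => ?_))
  exact_mod_cast div_nonneg (Real.log_natCast_nonneg _) (Nat.cast_nonneg _)

theorem isOpen_indist [TopologicalSpace X] {ℱ : Finset (Set X)}
    (hℱ : ∀ B ∈ (ℱ : Set (Set X)), IsClopen B) (x : X) :
    IsOpen {y | Indist (ℱ : Set (Set X)) x y} := by
  have : {y | Indist (ℱ : Set (Set X)) x y} = ⋂ B ∈ ℱ, {y | x ∈ B ↔ y ∈ B} := by
    ext y; simp [Indist]
  rw [this]
  refine isOpen_biInter_finset fun B hB => ?_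
  by_cases hx : x ∈ B
  · simpa [hx] using (hℱ B hB).isOpen
  · have : {y | x ∈ B ↔ y ∈ B} = Bᶜ := by ext y; simp [hx]
    rw [this]
    exact (hℱ B hB).compl.isOpen

/-- A point of each class of `Indist 𝔅` being given an open set that contains the class, finitely
many members of `𝔅` already cut `X` into pieces each contained in one of those open sets. -/
theorem exists_finite_subfamily [TopologicalSpace X] [CompactSpace X] {𝔅 : Set (Set X)}
    (h𝔅 : ∀ B ∈ 𝔅, IsClopen B) (O : X → Set X) (hO : ∀ x, IsOpen (O x))
    (hcl : ∀ x y, Indist 𝔅 x y → y ∈ O x) :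
    ∃ ℱ : Finset (Set X), (ℱ : Set (Set X)) ⊆ 𝔅 ∧
      ∀ x, ∃ z, ∀ y, Indist (ℱ : Set (Set X)) x y → y ∈ O z := by
  classical
  have hloc : ∀ x, ∃ ℱ : Finset (Set X), (ℱ : Set (Set X)) ⊆ 𝔅 ∧
      ∀ y, Indist (ℱ : Set (Set X)) x y → y ∈ O x := by
    intro x
    have hcpt : IsCompact (O x)ᶜ := (hO x).isClosed_compl.isCompact
    have hcov : (O x)ᶜ ⊆ ⋃ B : 𝔅, {y | ¬ (x ∈ B.1 ↔ y ∈ B.1)} := by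
      intro y hy
      have : ¬ Indist 𝔅 x y := fun h => hy (hcl x y h)
      simp only [Indist, not_forall] at this
      obtain ⟨B, hB, hxy⟩ := this
      exact mem_iUnion.2 ⟨⟨B, hB⟩, hxy⟩
    have hop : ∀ B : 𝔅, IsOpen {y | ¬ (x ∈ B.1 ↔ y ∈ B.1)} := by
      rintro ⟨B, hB⟩
      by_cases hx : x ∈ B
      · have : {y | ¬ (x ∈ B ↔ y ∈ B)} = Bᶜ := by ext y; simp [hx]
        rw [this]
        exact (h𝔅 B hB).compl.isOpen
      · have : {y | ¬ (x ∈ B ↔ y ∈ B)} = B := by ext y; simp [hx]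
        rw [this]
        exact (h𝔅 B hB).isOpen
    obtain ⟨t, ht⟩ := hcpt.elim_finite_subcover _ hop hcov
    refine ⟨t.image Subtype.val, ?_, ?_⟩
    · intro B hB
      obtain ⟨B', _, rfl⟩ := Finset.mem_image.1 (Finset.mem_coe.1 hB)
      exact B'.2
    · intro y hy
      by_contra hyO
      obtain ⟨B, hB⟩ := mem_iUnion.1 (ht hyO)
      obtain ⟨hBt, hB⟩ := mem_iUnion.1 hB
      exact hB (hy B.1 (Finset.mem_coe.2 (Finset.mem_image_of_mem _ hBt)))
  choose ℱ hℱ𝔅 hℱ using hloc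
  have hop : ∀ x, IsOpen {y | Indist (ℱ x : Set (Set X)) x y} := fun x =>
    isOpen_indist (fun B hB => h𝔅 B (hℱ𝔅 x hB)) x
  obtain ⟨t, ht⟩ := isCompact_univ.elim_finite_subcover _ hop
    (fun x _ => mem_iUnion.2 ⟨x, fun _ _ => Iff.rfl⟩)
  refine ⟨t.biUnion ℱ, ?_, fun x => ?_⟩
  · intro B hB
    obtain ⟨x, _, hx⟩ := Finset.mem_biUnion.1 (Finset.mem_coe.1 hB)
    exact hℱ𝔅 x hx
  · obtain ⟨z, hz⟩ := mem_iUnion.1 (ht (mem_univ x))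
    obtain ⟨hzt, hz⟩ := mem_iUnion.1 hz
    refine ⟨z, fun y hy => hℱ z y (Indist.trans hz (hy.mono ?_))⟩
    exact Finset.coe_subset.2 (Finset.subset_biUnion_of_mem ℱ hzt)

end Names

/-! ### Entropy of a factor as entropy of a family. -/

section FactorEntropy

variable {G : Type w} [Group G] {X : Type u} [TopologicalSpace X] [MulAction G X]
  {Z : Type v} [TopologicalSpace Z] [MulAction G Z]

/-- A finite open cover of a factor is dominated by a finite subfamily of a family generating the
factor. -/
theorem exists_subfamily_dominating_cover [CompactSpace X] {q : X → Z} (hq : IsFactorMap G q)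
    {𝔅 : Set (Set X)} (h𝔅 : ∀ B ∈ 𝔅, IsClopen B)
    (hfib : ∀ x y, Indist 𝔅 x y → q x = q y)
    {𝒰 : Set (Set Z)} (h𝒰 : IsFiniteOpenCover 𝒰) :
    ∃ ℱ : Finset (Set X), (ℱ : Set (Set X)) ⊆ 𝔅 ∧ ∀ E : Finset G,
      ∃ 𝒲 : Finset (Set Z), (𝒲 : Set (Set Z)) ⊆ coverJoin 𝒰 E ∧
        ⋃₀ (𝒲 : Set (Set Z)) = univ ∧ 𝒲.card ≤ nameCount (X := X) (ℱ : Set (Set X)) (E : Set G) := by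
  classical
  have hU : ∀ x, ∃ U ∈ 𝒰, q x ∈ U := fun x => by
    simpa using (h𝒰.covers ▸ mem_univ (q x) : q x ∈ ⋃₀ 𝒰)
  choose U hU𝒰 hqU using hU
  obtain ⟨ℱ, hℱ𝔅, hℱ⟩ := exists_finite_subfamily h𝔅 (fun x => q ⁻¹' U x)
    (fun x => (h𝒰.isOpen _ (hU𝒰 x)).preimage hq.continuous)
    (fun x y h => by simpa [← hfib x y h] using hqU x)
  choose z hz using hℱ
  refine ⟨ℱ, hℱ𝔅, fun E => ?_⟩
  have hfin : (range (itinerary (X := X) (ℱ : Set (Set X)) (E : Set G))).Finite :=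
    finite_range_itinerary ℱ.finite_toSet E.finite_toSet
  -- `V x` is a member of the join that contains the image of every point with the itinerary of `x`,
  -- so one representative per itinerary gives a subcover.
  let V : X → Set Z := fun x => ⋂ g ∈ E, (fun y : Z => g • y) ⁻¹' U (z (g • x))
  choose r hr using fun i : hfin.toFinset => hfin.mem_toFinset.1 i.2
  refine ⟨hfin.toFinset.attach.image (fun i => V (r i)), ?_, ?_, ?_⟩
  · intro W hW
    obtain ⟨i, _, rfl⟩ := Finset.mem_image.1 (Finset.mem_coe.1 hW)
    exact ⟨fun g => U (z (g • r i)), fun g _ => hU𝒰 _, rfl⟩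
  · refine eq_univ_of_forall fun y => ?_
    obtain ⟨x, rfl⟩ := hq.surjective y
    let i : hfin.toFinset := ⟨itinerary (ℱ : Set (Set X)) (E : Set G) x, by simp⟩
    refine mem_sUnion.2 ⟨V (r i), ?_, ?_⟩
    · exact Finset.mem_coe.2 (Finset.mem_image_of_mem _ (Finset.mem_attach _ i))
    · have := itinerary_eq_iff.1 (hr i)
      simp only [V, mem_iInter, mem_preimage]
      intro g hg
      rw [← hq.map_smul]
      exact hz _ _ (this g hg)
  · refine Finset.card_image_le.trans ?_
    rw [Finset.card_attach, nameCount, ncard_eq_toFinset_card _ hfin]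

/-- The entropy of a factor equals the entropy of a family of clopen sets whose classes are the
fibres of the factor map. -/
theorem topEntropy_eq_familyEntropy [CompactSpace X] [T2Space Z] {q : X → Z}
    (hq : IsFactorMap G q) {𝔅 : Set (Set X)} (h𝔅 : ∀ B ∈ 𝔅, IsClopen B)
    (hfib : ∀ x y, q x = q y ↔ Indist 𝔅 x y) (F : ℕ → Finset G) :
    topEntropy F Z = familyEntropy F 𝔅 := by
  classical
  apply le_antisymm
  · refine iSup₂_le fun 𝒰 h𝒰 => ?_
    obtain ⟨ℱ, hℱ, hE⟩ :=
      exists_subfamily_dominating_cover hq h𝔅 (fun x y => (hfib x y).2) h𝒰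
    refine le_iSup₂_of_le ℱ hℱ (limsup_le_limsup (Eventually.of_forall fun n => ?_))
    obtain ⟨𝒲, h1, h2, h3⟩ := hE (F n)
    have hN : coverNumber (coverJoin 𝒰 (F n)) ≤ nameCount (X := X) (ℱ : Set (Set X)) (F n : Set G) :=
      le_trans (Nat.sInf_le ⟨𝒲, h1, h2, rfl⟩) h3
    exact EReal.coe_le_coe_iff.2
      (div_le_div_of_nonneg_right (log_natCast_mono hN) (Nat.cast_nonneg _))
  · refine iSup₂_le fun ℱ hℱ => ?_
    -- As `ℱ ⊆ 𝔅`, the classes of `ℱ` are unions of fibres of `q`. Their images therefore partition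
    -- `Z`, and each is open because its complement is the image of a compact set.
    let 𝒰 : Set (Set Z) := range fun x : X => q '' {y | Indist (ℱ : Set (Set X)) x y}
    have h𝒰 : IsFiniteOpenCover 𝒰 := by
      refine ⟨?_, ?_, ?_⟩
      · have : 𝒰 ⊆ (fun 𝒜 : Set (Set X) =>
            q '' {y | ∀ B ∈ (ℱ : Set (Set X)), B ∈ 𝒜 ↔ y ∈ B}) '' {𝒜 | 𝒜 ⊆ (ℱ : Set (Set X))} := by
          rintro _ ⟨x, rfl⟩
          refine ⟨{B | B ∈ ℱ ∧ x ∈ B}, fun B hB => hB.1, ?_⟩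
          have : {y | ∀ B ∈ (ℱ : Set (Set X)), B ∈ {B | B ∈ ℱ ∧ x ∈ B} ↔ y ∈ B} =
              {y | Indist (ℱ : Set (Set X)) x y} := by
            ext y
            simp +contextual [Indist]
          exact congrArg _ this
        exact (ℱ.finite_toSet.finite_subsets.image _).subset this
      · rintro _ ⟨x, rfl⟩
        have hop : IsOpen {y | Indist (ℱ : Set (Set X)) x y} :=
          isOpen_indist (fun B hB => h𝔅 B (hℱ hB)) x
        rw [← isClosed_compl_iff]
        have : (q '' {y | Indist (ℱ : Set (Set X)) x y})ᶜ =
            q '' {y | Indist (ℱ : Set (Set X)) x y}ᶜ := by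
          ext z
          obtain ⟨y, rfl⟩ := hq.surjective z
          constructor
          · intro h
            exact ⟨y, fun hy => h ⟨y, hy, rfl⟩, rfl⟩
          · rintro ⟨y', hy', hyy'⟩ ⟨y'', hy'', hyy''⟩
            exact hy' (Indist.trans hy'' (((hfib _ _).1 (hyy''.trans hyy'.symm)).mono hℱ))
        rw [this]
        exact (hop.isClosed_compl.isCompact.image hq.continuous).isClosed
      · refine eq_univ_of_forall fun z => ?_
        obtain ⟨x, rfl⟩ := hq.surjective z
        exact mem_sUnion.2 ⟨_, ⟨x, rfl⟩, x, fun _ _ => Iff.rfl, rfl⟩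
    refine le_iSup₂_of_le 𝒰 h𝒰 (limsup_le_limsup (Eventually.of_forall fun n => ?_))
    obtain ⟨_, _, hE⟩ :=
      exists_subfamily_dominating_cover hq h𝔅 (fun x y => (hfib x y).2) h𝒰
    obtain ⟨𝒲₀, h1, h2, _⟩ := hE (F n)
    -- Since `sInf ∅ = 0`, a finite subcover must be exhibited before the minimum is known to be
    -- attained.
    have hne : {k | ∃ 𝒲 : Finset (Set Z), (𝒲 : Set (Set Z)) ⊆ coverJoin 𝒰 (F n) ∧
        ⋃₀ (𝒲 : Set (Set Z)) = univ ∧ 𝒲.card = k}.Nonempty := ⟨_, 𝒲₀, h1, h2, rfl⟩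
    obtain ⟨𝒲, hsub, hcov, hcard⟩ := Nat.sInf_mem hne
    have hN : nameCount (X := X) (ℱ : Set (Set X)) (F n : Set G) ≤
        coverNumber (coverJoin 𝒰 (F n)) := by
      rw [coverNumber, ← hcard]
      -- A member of the subcover containing `q x` fixes the cell of each `g • q x`, hence the
      -- itinerary of `x`, because the cells are disjoint.
      have hW : ∀ x : X, ∃ W : 𝒲, q x ∈ W.1 := fun x => by
        have : q x ∈ ⋃₀ (𝒲 : Set (Set Z)) := hcov ▸ mem_univ _
        obtain ⟨W, hW, hx⟩ := this
        exact ⟨⟨W, hW⟩, hx⟩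
      choose W hW using hW
      have h3 := ncard_range_le_of_factor (itinerary (ℱ : Set (Set X)) (F n : Set G)) W
        (toFinite _) (fun x y hxy => itinerary_eq_iff.2 fun g hg => ?_)
      · refine h3.trans ?_
        refine (ncard_le_card _).trans ?_
        simp
      · obtain ⟨U, hU, hWU⟩ := hsub (W x).2
        have hx := hW x
        have hy := hW y
        rw [← hxy] at hy
        rw [hWU] at hx hy
        simp only [mem_iInter, mem_preimage] at hx hy
        have hxg := hx g hg
        have hyg := hy g hg
        obtain ⟨a, ha⟩ := hU g hg
        rw [← ha, ← hq.map_smul] at hxg hyg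
        obtain ⟨x', hx', hxx'⟩ := hxg
        obtain ⟨y', hy', hyy'⟩ := hyg
        have e1 := ((hfib _ _).1 hxx').mono hℱ
        have e2 := ((hfib _ _).1 hyy').mono hℱ
        exact e1.symm.trans (hx'.symm.trans (Indist.trans hy' e2))
    exact EReal.coe_le_coe_iff.2
      (div_le_div_of_nonneg_right (log_natCast_mono hN) (Nat.cast_nonneg _))

end FactorEntropy

/-! ### The entropy cost of adjoining one set. -/

section Adjoin

variable {G : Type w} [Group G] {X : Type u} [MulAction G X]

/-- If the visits to `A` are determined by finitely many members of `𝔅` up to `exp (ε |F n|)`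
choices, then adjoining the translates of `A` to `𝔅` raises the entropy by at most `ε`. -/
theorem familyEntropy_adjoin_le {F : ℕ → Finset G} (hF : IsFolnerSeq F) {𝔅 : Set (Set X)}
    {A : Set X} {ε : ℝ} (hε : 0 ≤ ε)
    (h : ∀ S : Finset G, S.Nonempty → ∃ ℱ : Finset (Set X), (ℱ : Set (Set X)) ⊆ 𝔅 ∧
      ∀ᶠ n in atTop, ∀ x : X,
        ((visits A ((S : Set G) * (F n : Set G)) ''
          {y | itinerary (ℱ : Set (Set X)) (F n : Set G) y =
            itinerary (ℱ : Set (Set X)) (F n : Set G) x}).ncard : ℝ) ≤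
          Real.exp (ε * (F n).card)) :
    familyEntropy F (𝔅 ∪ range fun g : G => (fun x : X => g • x) ⁻¹' A) ≤
      familyEntropy F 𝔅 + (ε : EReal) := by
  classical
  refine iSup₂_le fun ℱ hℱ => ?_
  have hg : ∀ B ∈ range (fun g : G => (fun x : X => g • x) ⁻¹' A),
      ∃ g : G, (fun x : X => g • x) ⁻¹' A = B := fun B hB => hB
  choose! s hs using hg
  -- The element `1` only guarantees that `S` is nonempty.
  let S : Finset G := insert 1 (ℱ.image s)
  obtain ⟨ℱ₁, hℱ₁, hev⟩ := h S ⟨1, by simp [S]⟩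
  let ℱ' : Finset (Set X) := ℱ.filter (· ∈ 𝔅) ∪ ℱ₁
  have hℱ' : (ℱ' : Set (Set X)) ⊆ 𝔅 := by
    intro B hB
    rcases Finset.mem_union.1 (Finset.mem_coe.1 hB) with hB | hB
    · exact (Finset.mem_filter.1 hB).2
    · exact hℱ₁ hB
  have hmain : ∀ᶠ n in atTop,
      ((Real.log (nameCount (ℱ : Set (Set X)) (F n : Set G)) / ((F n).card : ℝ) : ℝ) : EReal) ≤
      ((Real.log (nameCount (ℱ' : Set (Set X)) (F n : Set G)) / ((F n).card : ℝ) : ℝ) : EReal)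
        + (ε : EReal) := by
    filter_upwards [hev] with n hn
    have hpos : (0 : ℝ) < (F n).card := by exact_mod_cast (hF.nonempty n).card_pos
    have hSF : ((S : Set G) * (F n : Set G)).Finite := S.finite_toSet.mul (F n).finite_toSet
    have hf := finite_range_visits A hSF
    have hg := finite_range_itinerary (X := X) ℱ'.finite_toSet (F n).finite_toSet
    -- A visit of `g • x` to the translate of `A` by `s` is a visit to `A` at time `s * g`, so
    -- visits over `S F n` together with the `ℱ'`-itinerary determine the `ℱ`-itinerary.
    have h1 : nameCount (ℱ : Set (Set X)) (F n : Set G) ≤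
        (range fun x : X => (visits A ((S : Set G) * (F n : Set G)) x,
          itinerary (ℱ' : Set (Set X)) (F n : Set G) x)).ncard := by
      refine ncard_range_le_of_factor _ _ ((hf.prod hg).subset ?_) ?_
      · rintro _ ⟨x, rfl⟩
        exact ⟨mem_range_self x, mem_range_self x⟩
      · intro x y hxy
        obtain ⟨hv, hi⟩ := Prod.mk.inj hxy
        rw [itinerary_eq_iff] at hi ⊢
        intro g hg B hB
        rcases hℱ hB with hB' | hB'
        · exact hi g hg B (Finset.mem_coe.2 (Finset.mem_union_left _
            (Finset.mem_filter.2 ⟨hB, hB'⟩)))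
        · have hsS : s B * g ∈ (S : Set G) * (F n : Set G) := by
            refine Set.mul_mem_mul ?_ hg
            exact Finset.mem_coe.2 (Finset.mem_insert_of_mem (Finset.mem_image_of_mem _ hB))
          have hvv := Set.ext_iff.1 hv (s B * g)
          have key : s B • g • x ∈ A ↔ s B • g • y ∈ A := by
            simpa [visits, hsS, mul_smul] using hvv
          rw [← hs B hB']
          exact key
    have h2 := ncard_range_prod_le (visits A ((S : Set G) * (F n : Set G)))
      (itinerary (ℱ' : Set (Set X)) (F n : Set G)) hf hg (Real.exp (ε * (F n).card)) (by
        intro x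
        refine le_trans ?_ (hn x)
        have hsub : visits A ((S : Set G) * (F n : Set G)) ''
            {y | itinerary (ℱ' : Set (Set X)) (F n : Set G) y =
              itinerary (ℱ' : Set (Set X)) (F n : Set G) x} ⊆
            visits A ((S : Set G) * (F n : Set G)) ''
            {y | itinerary (ℱ₁ : Set (Set X)) (F n : Set G) y =
              itinerary (ℱ₁ : Set (Set X)) (F n : Set G) x} := by
          refine image_mono fun y hy => itinerary_eq_iff.2 fun g hg => ?_
          exact (itinerary_eq_iff.1 hy g hg).mono
            (Finset.coe_subset.2 Finset.subset_union_right)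
        exact_mod_cast ncard_le_ncard hsub (hf.subset (image_subset_range _ _)))
    have h3 : ((nameCount (X := X) (ℱ : Set (Set X)) (F n : Set G) : ℕ) : ℝ) ≤
        (nameCount (X := X) (ℱ' : Set (Set X)) (F n : Set G) : ℕ) * Real.exp (ε * (F n).card) :=
      le_trans (by exact_mod_cast h1) h2
    have h4 : Real.log (nameCount (X := X) (ℱ : Set (Set X)) (F n : Set G)) ≤
        Real.log (nameCount (X := X) (ℱ' : Set (Set X)) (F n : Set G)) + ε * (F n).card := by
      rcases Nat.eq_zero_or_pos (nameCount (X := X) (ℱ : Set (Set X)) (F n : Set G)) with h0 | h0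
      · rw [h0]
        have := Real.log_natCast_nonneg (nameCount (X := X) (ℱ' : Set (Set X)) (F n : Set G))
        simp only [Nat.cast_zero, Real.log_zero]
        positivity
      · have h0' : (0 : ℝ) < (nameCount (X := X) (ℱ : Set (Set X)) (F n : Set G) : ℕ) := by
          exact_mod_cast h0
        have h5 : ((nameCount (X := X) (ℱ' : Set (Set X)) (F n : Set G) : ℕ) : ℝ) ≠ 0 := by
          intro h6
          rw [h6, zero_mul] at h3
          linarith
        calc _ ≤ Real.log _ := Real.log_le_log h0' h3
          _ = _ := by rw [Real.log_mul h5 (Real.exp_pos _).ne', Real.log_exp]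
    rw [← EReal.coe_add, EReal.coe_le_coe_iff, div_le_iff₀ hpos, add_mul, div_mul_cancel₀ _ hpos.ne']
    exact h4
  calc nameEntropy F (ℱ : Set (Set X)) ≤ limsup ((fun n =>
      ((Real.log (nameCount (ℱ' : Set (Set X)) (F n : Set G)) / ((F n).card : ℝ) : ℝ) : EReal))
        + fun _ => (ε : EReal)) atTop := limsup_le_limsup (hmain.mono fun n hn => hn)
    _ ≤ nameEntropy F (ℱ' : Set (Set X)) + limsup (fun _ : ℕ => (ε : EReal)) atTop :=
      EReal.limsup_add_le (Or.inr (by simp)) (Or.inr (by simp))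
    _ ≤ familyEntropy F 𝔅 + (ε : EReal) := by
      rw [limsup_const]
      gcongr
      exact le_iSup₂_of_le ℱ' hℱ' le_rfl

/-- If no orbit visits `A` twice along a translate of `K`, then it visits `A` in `E` at most
`|K⁻¹ E| / |K|` times. -/
theorem ncard_visits_mul_le {A : Set X} {K : Finset G} {E : Set G} (hE : E.Finite)
    (hA : ∀ g ∈ K, ∀ h ∈ K, g ≠ h → ∀ z : X, g • z ∈ A → h • z ∉ A) (x : X) :
    (visits A E x).ncard * K.card ≤ ((K : Set G)⁻¹ * E).ncard := by
  have hfin : ((K : Set G)⁻¹ * E).Finite := K.finite_toSet.inv.mul hE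
  -- If `k⁻¹ t = k'⁻¹ t'`, then the point `z = (k⁻¹ t) • x` is brought into `A` by both `k` and
  -- `k'`, so `k = k'`.
  have hinj : InjOn (fun p : G × G => p.2⁻¹ * p.1) (visits A E x ×ˢ (K : Set G)) := by
    rintro ⟨t, k⟩ ⟨ht, hk⟩ ⟨t', k'⟩ ⟨ht', hk'⟩ heq
    simp only at heq hk hk' ht ht'
    have hkk : k = k' := by
      by_contra hne
      refine hA k hk k' hk' hne ((k⁻¹ * t) • x) ?_ ?_
      · simpa [smul_smul] using ht.2
      · rw [heq]
        simpa [smul_smul] using ht'.2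
    subst hkk
    simpa using heq
  rw [← ncard_coe_finset K, ← ncard_prod, ← hinj.ncard_image]
  refine ncard_le_ncard ?_ hfin
  rintro _ ⟨⟨t, k⟩, ⟨ht, hk⟩, rfl⟩
  exact Set.mul_mem_mul (Set.inv_mem_inv.2 hk) ht.1

/-- A set that is rarely visited has few visit patterns. -/
theorem eventually_ncard_visits_le_of_sparse {F : ℕ → Finset G} (hF : IsFolnerSeq F) {ε : ℝ}
    (hε : 0 < ε) :
    ∃ k₀ : ℕ, ∀ (K : Finset G) (A : Set X), K.card = k₀ →
      (∀ g ∈ K, ∀ h ∈ K, g ≠ h → ∀ z : X, g • z ∈ A → h • z ∉ A) →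
      ∀ S : Finset G, S.Nonempty → ∀ᶠ n in atTop, ∀ P : Set X,
        ((visits A ((S : Set G) * (F n : Set G)) '' P).ncard : ℝ) ≤
          Real.exp (ε * (F n).card) := by
  classical
  -- The exponent is at most `2 |F n| t + (2 |F n| / k) log t⁻¹`; `t` and then `k` are chosen to
  -- make each term at most `ε |F n| / 2`.
  set t : ℝ := min 1 (ε / 4)
  have ht : 0 < t := lt_min one_pos (by positivity)
  have ht1 : t ≤ 1 := min_le_left _ _
  have htε : t ≤ ε / 4 := min_le_right _ _
  have hl : 0 ≤ Real.log t⁻¹ := Real.log_nonneg ((one_le_inv₀ ht).2 ht1)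
  obtain ⟨k, hk⟩ := exists_nat_gt (4 * Real.log t⁻¹ / ε)
  have hk0 : (0 : ℝ) < k := lt_of_le_of_lt (by positivity) hk
  refine ⟨k, fun K A hKk hA S hS => ?_⟩
  have hKn : K.Nonempty := by
    rw [← Finset.card_pos, hKk]
    exact_mod_cast hk0
  filter_upwards [hF.eventually_ncard_mul_le S hS,
    hF.eventually_ncard_mul_le (K⁻¹ * S) (hKn.inv.mul hS)] with n h1 h2 P
  have hSF : ((S : Set G) * (F n : Set G)).Finite := S.finite_toSet.mul (F n).finite_toSet
  have hcoe : (((S * F n : Finset G)) : Set G) = (S : Set G) * (F n : Set G) := by push_cast; rfl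
  have hsub : visits A ((S : Set G) * (F n : Set G)) '' P ⊆
      {T : Set G | T ⊆ ((S * F n : Finset G) : Set G) ∧
        (T.ncard : ℝ) ≤ 2 * (F n).card / k} := by
    rintro _ ⟨x, _, rfl⟩
    refine ⟨fun g hg => hcoe ▸ hg.1, ?_⟩
    have h3 := ncard_visits_mul_le hSF hA x
    rw [hKk] at h3
    rw [Finset.coe_mul, Finset.coe_inv, mul_assoc] at h2
    rw [le_div_iff₀ hk0]
    exact le_trans (by exact_mod_cast h3) h2
  have hfin : {T : Set G | T ⊆ ((S * F n : Finset G) : Set G) ∧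
      (T.ncard : ℝ) ≤ 2 * (F n).card / k}.Finite :=
    (S * F n).finite_toSet.finite_subsets.subset fun T hT => hT.1
  calc _ ≤ _ := Nat.cast_le.2 (ncard_le_ncard hsub hfin)
    _ ≤ _ := card_small_subsets_le (S * F n) (2 * (F n).card / k) t ht ht1
    _ ≤ _ := by
      refine Real.exp_le_exp.2 ?_
      have h5 : ((S * F n).card : ℝ) ≤ 2 * (F n).card := by
        rwa [← hcoe, ncard_coe_finset] at h1
      have h6 : Real.log t⁻¹ / k ≤ ε / 4 := by
        rw [div_le_iff₀ hk0]
        rw [div_lt_iff₀ hε] at hk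
        linarith
      have hn : (0 : ℝ) ≤ (F n).card := Nat.cast_nonneg _
      calc ((S * F n).card : ℝ) * t + 2 * (F n).card / k * Real.log t⁻¹
          = ((S * F n).card : ℝ) * t + 2 * (F n).card * (Real.log t⁻¹ / k) := by ring
        _ ≤ (2 * (F n).card) * (ε / 4) + 2 * (F n).card * (ε / 4) := by gcongr
        _ = ε * (F n).card := by ring

/-- If finitely many invariantly given sets leave few visit patterns along `K⁻¹ K`, then they
leave few visit patterns along the Følner sequence. -/
theorem exists_eventually_ncard_visits_le {F : ℕ → Finset G} (hF : IsFolnerSeq F)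
    {𝔅 : Set (Set X)} (hinv : ∀ g : G, ∀ B ∈ 𝔅, (fun x : X => g • x) ⁻¹' B ∈ 𝔅)
    {A : Set X} {ε : ℝ} {K : Finset G} (hK : K.Nonempty) {M : ℕ}
    (hMK : 2 * Real.log M ≤ ε * K.card) {ℱ : Finset (Set X)} (hℱ : (ℱ : Set (Set X)) ⊆ 𝔅)
    (hfew : ∀ x : X, (visits A ((K : Set G)⁻¹ * (K : Set G)) ''
      {y | Indist (ℱ : Set (Set X)) x y}).ncard ≤ M)
    (S : Finset G) (hS : S.Nonempty) :
    ∃ ℱ₁ : Finset (Set X), (ℱ₁ : Set (Set X)) ⊆ 𝔅 ∧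
      ∀ᶠ n in atTop, ∀ x : X,
        ((visits A ((S : Set G) * (F n : Set G)) ''
          {y | itinerary (ℱ₁ : Set (Set X)) (F n : Set G) y =
            itinerary (ℱ₁ : Set (Set X)) (F n : Set G) x}).ncard : ℝ) ≤
          Real.exp (ε * (F n).card) := by
  classical
  -- Pulling `ℱ` back by `S` lets an itinerary over `F n` record the `ℱ`-class of `c • x` for every
  -- `c ∈ S F n`, in particular for the centres of the covering.
  refine ⟨(S ×ˢ ℱ).image fun p => (fun x : X => p.1 • x) ⁻¹' p.2, ?_, ?_⟩
  · intro B hB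
    obtain ⟨p, hp, rfl⟩ := Finset.mem_image.1 (Finset.mem_coe.1 hB)
    exact hinv _ _ (hℱ (Finset.mem_product.1 hp).2)
  filter_upwards [hF.eventually_ncard_mul_le (K * S) (hK.mul hS)] with n hn x
  set E : Set G := (S : Set G) * (F n : Set G) with hEdef
  set L : Set G := (K : Set G)⁻¹ * (K : Set G) with hLdef
  have hE : E.Finite := S.finite_toSet.mul (F n).finite_toSet
  have hL : L.Finite := K.finite_toSet.inv.mul K.finite_toSet
  obtain ⟨C, hCE, hCK, hcov⟩ := exists_translates_cover (K : Set G) E K.finite_toSet hK hE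
  have hW : ∀ c : C, (visits A L '' {y | Indist (ℱ : Set (Set X)) (c.1 • x) y}).Finite :=
    fun c => (finite_range_visits A hL).subset (image_subset_range _ _)
  let W : Finset (C → Set G) := Fintype.piFinset fun c => (hW c).toFinset
  have hWcard : W.card ≤ M ^ C.card := by
    rw [Fintype.card_piFinset]
    refine (Finset.prod_le_pow_card _ _ M fun c _ => ?_).trans (by simp)
    rw [← ncard_eq_toFinset_card _ (hW c)]
    exact hfew _
  -- Reassembles the visits over `E` from the local patterns seen from the centres.
  let Φ : (C → Set G) → Set G := fun φ =>
    {e | e ∈ E ∧ ∃ c : C, ∃ l ∈ φ c, e = l * c.1}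
  have hsub : visits A E '' {y |
      itinerary (((S ×ˢ ℱ).image fun p => (fun x : X => p.1 • x) ⁻¹' p.2 : Finset (Set X)) :
        Set (Set X)) (F n : Set G) y =
      itinerary (((S ×ˢ ℱ).image fun p => (fun x : X => p.1 • x) ⁻¹' p.2 : Finset (Set X)) :
        Set (Set X)) (F n : Set G) x} ⊆ Φ '' (W : Set (C → Set G)) := by
    rintro _ ⟨y, hy, rfl⟩
    refine ⟨fun c => visits A L (c.1 • y), ?_, ?_⟩
    · refine Finset.mem_coe.2 (Fintype.mem_piFinset.2 fun c => ?_)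
      rw [Finite.mem_toFinset]
      refine ⟨c.1 • y, fun B hB => ?_, rfl⟩
      obtain ⟨s, hs, f, hf, hc⟩ := Set.mem_mul.1 (hCE c.2)
      have := (itinerary_eq_iff.1 hy f hf).symm ((fun x : X => s • x) ⁻¹' B)
        (Finset.mem_coe.2 (Finset.mem_image.2 ⟨(s, B), Finset.mem_product.2 ⟨hs, hB⟩, rfl⟩))
      rw [← hc, mul_smul, mul_smul]
      exact this
    · ext e
      constructor
      · rintro ⟨he, c, l, hl, rfl⟩
        exact ⟨he, by simpa [mul_smul] using hl.2⟩
      · rintro ⟨he, hA⟩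
        obtain ⟨c, hc, k, hk, k', hk', rfl⟩ := hcov e he
        refine ⟨he, ⟨c, hc⟩, k⁻¹ * k', ⟨?_, by simpa [mul_smul] using hA⟩, rfl⟩
        exact Set.mul_mem_mul (Set.inv_mem_inv.2 hk) hk'
  have h1 := (ncard_le_ncard hsub (W.finite_toSet.image _)).trans
    (ncard_image_le W.finite_toSet)
  rw [ncard_coe_finset] at h1
  have hM : 0 < M := by
    refine lt_of_lt_of_le ?_ (hfew x)
    rw [ncard_pos ((finite_range_visits A hL).subset (image_subset_range _ _))]
    exact ⟨_, x, fun _ _ => Iff.rfl, rfl⟩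
  rw [Finset.coe_mul, mul_assoc, ← hEdef] at hn
  rw [ncard_coe_finset] at hCK
  calc _ ≤ ((M ^ C.card : ℕ) : ℝ) := Nat.cast_le.2 (h1.trans hWcard)
    _ = Real.exp (C.card * Real.log M) := by
      rw [Real.exp_nat_mul, Real.exp_log (by exact_mod_cast hM)]
      push_cast
      rfl
    _ ≤ Real.exp (ε * (F n).card) := by
      refine Real.exp_le_exp.2 ?_
      have h2 : ((C.card * K.card : ℕ) : ℝ) ≤ 2 * (F n).card :=
        le_trans (by exact_mod_cast hCK) hn
      push_cast at h2
      have hlog : 0 ≤ Real.log M := Real.log_natCast_nonneg M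
      have hKpos : (0 : ℝ) < K.card := by exact_mod_cast hK.card_pos
      have hεn : 0 ≤ ε := by
        by_contra hneg
        push Not at hneg
        nlinarith
      have hC0 : (0 : ℝ) ≤ C.card := Nat.cast_nonneg _
      nlinarith [mul_le_mul_of_nonneg_left hMK hC0, mul_le_mul_of_nonneg_left h2 hεn]

end Adjoin

/-! ### Enlarging a family at small cost. -/

section SmallStep

variable {G : Type w} [Group G] {X : Type u} [TopologicalSpace X] [MulAction G X]

theorem eventually_smallSets_smul_notMem [T2Space X]
    (hcont : ∀ g : G, Continuous fun x : X => g • x) {x : X} {g : G} (hg : g • x ≠ x) :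
    ∀ᶠ A in (𝓝 x).smallSets, ∀ a ∈ A, g • a ∉ A := by
  obtain ⟨U, V, hU, hV, hxU, hxV, hUV⟩ := t2_separation hg
  refine eventually_smallSets.2 ⟨V ∩ (fun y : X => g • y) ⁻¹' U,
    inter_mem (hV.mem_nhds hxV) ((hU.preimage (hcont g)).mem_nhds hxU), fun t ht a ha hga => ?_⟩
  exact disjoint_left.1 hUV (ht ha).2 (ht hga).1

/-- Stating requirements on `A` through `smallSets` allows finitely many of them to be imposed at
once before a basic clopen set is picked. -/
theorem exists_isClopen_of_eventually_smallSets
    (hbas : TopologicalSpace.IsTopologicalBasis {s : Set X | IsClopen s}) {x : X}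
    {P : Set X → Prop} (h : ∀ᶠ A in (𝓝 x).smallSets, P A) :
    ∃ A, IsClopen A ∧ x ∈ A ∧ P A := by
  obtain ⟨A, ⟨hA, hx⟩, hP⟩ := h.exists_mem_basis_of_smallSets hbas.nhds_hasBasis
  exact ⟨A, hA, hx, hP⟩

theorem eventually_smallSets_notMem [T1Space X] {x y : X} (h : y ≠ x) :
    ∀ᶠ A in (𝓝 x).smallSets, y ∉ A :=
  eventually_smallSets.2 ⟨{y}ᶜ, isOpen_compl_singleton.mem_nhds (by simpa using h.symm),
    fun _ ht hy => ht hy rfl⟩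

/-- If `A` is a small neighbourhood of a point whose orbit is as large as those of the points
lying in nontrivial classes, the points of a class have few visit patterns to `A`. -/
theorem exists_isClopen_few_visits [T2Space X]
    (hbas : TopologicalSpace.IsTopologicalBasis {s : Set X | IsClopen s})
    (hcont : ∀ g : G, Continuous fun x : X => g • x) {𝔅 : Set (Set X)} {x x' : X}
    (hne : x' ≠ x) (hfin : (MulAction.orbit G x).Finite)
    (hmax : ∀ y z : X, y ≠ z → Indist 𝔅 y z → (MulAction.orbit G z).Finite ∧
      (MulAction.orbit G z).ncard ≤ (MulAction.orbit G x).ncard)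
    {L : Set G} (hL : L.Finite) :
    ∃ A, IsClopen A ∧ x ∈ A ∧ x' ∉ A ∧
      ∀ z, (visits A L '' {y | Indist 𝔅 z y}).ncard ≤ (MulAction.orbit G x).ncard + 1 := by
  classical
  have hσ : ∀ o ∈ MulAction.orbit G x, ∃ g : G, g • x = o := fun o ho => ho
  choose! σ hσ using hσ
  -- a neighbourhood of `x` on which orbits of at most that size have the shape of the orbit of `x`
  have hA₀ : ∀ᶠ A in (𝓝 x).smallSets,
      (∀ o ∈ MulAction.orbit G x, ∀ o' ∈ MulAction.orbit G x, o ≠ o' →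
        ∀ a ∈ A, ((σ o')⁻¹ * σ o) • a ∉ A) ∧
      (∀ o ∈ MulAction.orbit G x, o ≠ x → ∀ a ∈ A, σ o • a ∉ A) := by
    refine Eventually.and ?_ ?_
    · refine (eventually_all_finite hfin).2 fun o ho => (eventually_all_finite hfin).2
        fun o' ho' => ?_
      by_cases hoo : o = o'
      · exact Eventually.of_forall fun _ h => (h hoo).elim
      · refine (eventually_smallSets_smul_notMem hcont ?_).mono fun _ h _ => h
        rw [mul_smul, hσ o ho, Ne, inv_smul_eq_iff, hσ o' ho']
        exact hoo
    · refine (eventually_all_finite hfin).2 fun o ho => ?_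
      by_cases hox : o = x
      · exact Eventually.of_forall fun _ h => (h hox).elim
      · refine (eventually_smallSets_smul_notMem hcont ?_).mono fun _ h _ => h
        rw [hσ o ho]
        exact hox
  obtain ⟨A₀, hA₀c, hxA₀, hsep, hret⟩ := exists_isClopen_of_eventually_smallSets hbas hA₀
  have hLL : (L * L⁻¹).Finite := hL.mul hL.inv
  -- Elements of `L L⁻¹` that move `x` push `A` off itself, while those that fix `x` keep `A` inside
  -- `A₀`.
  have hAev : ∀ᶠ A in (𝓝 x).smallSets, x' ∉ A ∧ A ⊆ A₀ ∧
      ∀ g ∈ L * L⁻¹, (g • x ≠ x → ∀ a ∈ A, g • a ∉ A) ∧ (g • x = x → ∀ a ∈ A, g • a ∈ A₀) := by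
    refine (eventually_smallSets_notMem hne).and (Eventually.and ?_ ?_)
    · exact eventually_smallSets.2 ⟨A₀, hA₀c.isOpen.mem_nhds hxA₀, fun _ h => h⟩
    · refine (eventually_all_finite hLL).2 fun g _ => Eventually.and ?_ ?_
      · by_cases hg : g • x = x
        · exact Eventually.of_forall fun _ h => (h hg).elim
        · exact (eventually_smallSets_smul_notMem hcont hg).mono fun _ h _ => h
      · by_cases hg : g • x = x
        · refine eventually_smallSets.2 ⟨(fun y : X => g • y) ⁻¹' A₀,
            (hA₀c.isOpen.preimage (hcont g)).mem_nhds (by simpa [hg] using hxA₀),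
            fun t ht _ a ha => ht ha⟩
        · exact Eventually.of_forall fun _ h => (hg h).elim
  obtain ⟨A, hAc, hxA, hx'A, hAA₀, hLA⟩ := exists_isClopen_of_eventually_smallSets hbas hAev
  refine ⟨A, hAc, hxA, hx'A, fun z => ?_⟩
  -- points of `A` with small orbits are fixed by the elements of `L L⁻¹` that fix `x`
  have hfix : ∀ a ∈ A, (MulAction.orbit G a).Finite →
      (MulAction.orbit G a).ncard ≤ (MulAction.orbit G x).ncard →
      ∀ g ∈ L * L⁻¹, g • x = x → g • a = a := by
    intro a ha hfa hca g hg hgx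
    -- The points `σ o • a` are distinct, so they exhaust an orbit that is no larger than that of
    -- `x`. Only `o = x` can lead back to `A₀`, so the orbit of `a` meets `A₀` in a single point.
    have hinj : InjOn (fun o => σ o • a) (MulAction.orbit G x) := by
      intro o ho o' ho' heq
      by_contra hoo
      refine hsep o ho o' ho' hoo a (hAA₀ ha) ?_
      rw [mul_smul]
      simp only at heq
      rw [heq, inv_smul_smul]
      exact hAA₀ ha
    have himg : (fun o => σ o • a) '' MulAction.orbit G x = MulAction.orbit G a := by
      refine eq_of_subset_of_ncard_le ?_ ?_ hfa
      · rintro _ ⟨o, _, rfl⟩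
        exact MulAction.mem_orbit a _
      · rw [hinj.ncard_image]
        exact hca
    have hkey : ∀ h : G, h • a ∈ A₀ → h • a = σ x • a := by
      intro h hh
      have : h • a ∈ (fun o => σ o • a) '' MulAction.orbit G x := himg ▸ MulAction.mem_orbit a h
      obtain ⟨o, ho, hoa⟩ := this
      simp only at hoa
      have hox : o = x := by
        by_contra hox
        exact hret o ho hox a (hAA₀ ha) (hoa ▸ hh)
      rw [← hoa, hox]
    have h1 := hkey g ((hLA g hg).2 hgx a ha)
    have h2 := hkey 1 (by simpa using hAA₀ ha)
    rw [h1, ← h2, one_smul]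
  by_cases htriv : ∀ y, Indist 𝔅 z y → y = z
  · have : visits A L '' {y | Indist 𝔅 z y} ⊆ {visits A L z} := by
      rintro _ ⟨y, hy, rfl⟩
      rw [htriv y hy]
      rfl
    refine (ncard_le_ncard this (finite_singleton _)).trans ?_
    simp
  push Not at htriv
  obtain ⟨z', hzz', hz'z⟩ := htriv
  have hsmall : ∀ y, Indist 𝔅 z y → (MulAction.orbit G y).Finite ∧
      (MulAction.orbit G y).ncard ≤ (MulAction.orbit G x).ncard := by
    intro y hy
    by_cases hyz : y = z
    · subst hyz
      exact hmax z' y hz'z hzz'.symm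
    · exact hmax z y (Ne.symm hyz) hy
  -- A nonempty pattern containing `l₀` is `{l ∈ L | l⁻¹ • x = l₀⁻¹ • x}`, determined by a point of
  -- the orbit of `x`; the empty pattern accounts for the `+ 1`.
  have hsub : visits A L '' {y | Indist 𝔅 z y} ⊆
      insert ∅ ((fun o : X => {l | l ∈ L ∧ l⁻¹ • x = o}) '' MulAction.orbit G x) := by
    rintro _ ⟨y, hy, rfl⟩
    rcases (visits A L y).eq_empty_or_nonempty with h0 | ⟨l₀, hl₀, hl₀A⟩
    · exact Or.inl h0
    refine Or.inr ⟨l₀⁻¹ • x, MulAction.mem_orbit _ _, ?_⟩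
    have horb : MulAction.orbit G (l₀ • y) = MulAction.orbit G y := MulAction.orbit_smul _ _
    have hs := hsmall y hy
    rw [← horb] at hs
    ext l
    constructor
    · rintro ⟨hl, hlx⟩
      have hg : l * l₀⁻¹ ∈ L * L⁻¹ := Set.mul_mem_mul hl (Set.inv_mem_inv.2 hl₀)
      have h1 := hfix _ hl₀A hs.1 hs.2 _ hg (by rw [mul_smul, ← hlx, smul_inv_smul])
      rw [smul_smul, inv_mul_cancel_right] at h1
      exact ⟨hl, by rw [h1]; exact hl₀A⟩
    · rintro ⟨hl, hlA⟩
      refine ⟨hl, ?_⟩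
      by_contra hlx
      have hg : l * l₀⁻¹ ∈ L * L⁻¹ := Set.mul_mem_mul hl (Set.inv_mem_inv.2 hl₀)
      refine (hLA _ hg).1 ?_ _ hl₀A ?_
      · intro h
        apply hlx
        rw [inv_smul_eq_iff, ← mul_smul, h]
      · rwa [smul_smul, inv_mul_cancel_right]
  refine (ncard_le_ncard hsub ((hfin.image _).insert _)).trans ?_
  refine (ncard_insert_le _ _).trans ?_
  exact Nat.add_le_add_right (ncard_image_le hfin) 1

theorem eventually_visits_eq (hcont : ∀ g : G, Continuous fun x : X => g • x) {A : Set X}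
    (hA : IsClopen A) {L : Set G} (hL : L.Finite) (x : X) :
    ∀ᶠ y in 𝓝 x, visits A L y = visits A L x := by
  have h : ∀ᶠ y in 𝓝 x, ∀ g ∈ L, (g • y ∈ A ↔ g • x ∈ A) := by
    refine (eventually_all_finite hL).2 fun g _ => ?_
    by_cases hx : g • x ∈ A
    · filter_upwards [(hA.isOpen.preimage (hcont g)).mem_nhds hx] with y hy
      exact ⟨fun _ => hx, fun _ => hy⟩
    · filter_upwards [(hA.compl.isOpen.preimage (hcont g)).mem_nhds hx] with y hy
      exact ⟨fun h => (hy h).elim, fun h => (hx h).elim⟩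
  filter_upwards [h] with y hy
  ext g
  exact and_congr_right fun hg => hy g hg

/-- A family of clopen sets that does not separate points can be enlarged by a clopen set which
it does not contain, at an arbitrarily small cost in entropy. -/
theorem exists_isClopen_familyEntropy_adjoin_le [Infinite G] [CompactSpace X] [T2Space X]
    (hbas : TopologicalSpace.IsTopologicalBasis {s : Set X | IsClopen s})
    (hcont : ∀ g : G, Continuous fun x : X => g • x)
    {F : ℕ → Finset G} (hF : IsFolnerSeq F) {𝔅 : Set (Set X)} (h𝔅 : ∀ B ∈ 𝔅, IsClopen B)
    (hinv : ∀ g : G, ∀ B ∈ 𝔅, (fun x : X => g • x) ⁻¹' B ∈ 𝔅)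
    (hns : ∃ x y : X, x ≠ y ∧ Indist 𝔅 x y) {ε : ℝ} (hε : 0 < ε) :
    ∃ A, IsClopen A ∧ A ∉ 𝔅 ∧
      familyEntropy F (𝔅 ∪ range fun g : G => (fun x : X => g • x) ⁻¹' A) ≤
        familyEntropy F 𝔅 + (ε : EReal) := by
  classical
  obtain ⟨k₀, hsparse⟩ := eventually_ncard_visits_le_of_sparse (X := X) hF hε
  by_cases hbig : ∃ x y : X, y ≠ x ∧ Indist 𝔅 y x ∧
      ∃ O : Finset X, (O : Set X) ⊆ MulAction.orbit G x ∧ O.card = k₀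
  · obtain ⟨x, y, hyx, hind, O, hO, hOc⟩ := hbig
    have hσ : ∀ o ∈ O, ∃ g : G, g • x = o := fun o ho => hO ho
    choose! σ hσ using hσ
    have hσinj : InjOn (fun o => (σ o)⁻¹) (O : Set X) := by
      intro o ho o' ho' heq
      rw [← hσ o ho, ← hσ o' ho', inv_injective heq]
    -- With inverses, two visits `(σ o)⁻¹ • z` and `(σ o')⁻¹ • z` to `A` differ by `(σ o')⁻¹ * σ o`,
    -- which moves `x`.
    let K : Finset G := O.image fun o => (σ o)⁻¹
    have hKc : K.card = k₀ := by rw [Finset.card_image_of_injOn hσinj, hOc]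
    have hev : ∀ᶠ A in (𝓝 x).smallSets, y ∉ A ∧
        ∀ o ∈ O, ∀ o' ∈ O, o ≠ o' → ∀ a ∈ A, ((σ o')⁻¹ * σ o) • a ∉ A := by
      refine (eventually_smallSets_notMem hyx).and ?_
      refine (eventually_all_finset O).2 fun o ho => (eventually_all_finset O).2 fun o' ho' => ?_
      by_cases hoo : o = o'
      · exact Eventually.of_forall fun _ h => (h hoo).elim
      · refine (eventually_smallSets_smul_notMem hcont ?_).mono fun _ h _ => h
        rw [mul_smul, hσ o ho, Ne, inv_smul_eq_iff, hσ o' ho']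
        exact hoo
    obtain ⟨A, hA, hxA, hyA, hsep⟩ := exists_isClopen_of_eventually_smallSets hbas hev
    refine ⟨A, hA, fun hA𝔅 => hyA ((hind A hA𝔅).2 hxA), ?_⟩
    -- Sparse visits have few patterns without any knowledge of the itinerary, so the empty
    -- subfamily suffices.
    refine familyEntropy_adjoin_le hF hε.le fun S hS => ⟨∅, by simp, ?_⟩
    refine (hsparse K A hKc ?_ S hS).mono fun n hn x => hn _
    intro g hg h hh hgh z hgz hhz
    obtain ⟨o, ho, rfl⟩ := Finset.mem_image.1 hg
    obtain ⟨o', ho', rfl⟩ := Finset.mem_image.1 hh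
    refine hsep o ho o' ho' (fun h => hgh (by rw [h])) _ hgz ?_
    rwa [mul_smul, smul_inv_smul]
  · push Not at hbig
    have hbdd : ∀ x y : X, y ≠ x → Indist 𝔅 y x →
        (MulAction.orbit G x).Finite ∧ (MulAction.orbit G x).ncard ≤ k₀ := by
      intro x y hyx hind
      have hfin : (MulAction.orbit G x).Finite := by
        by_contra hinf
        obtain ⟨O, hO, hOc⟩ := Set.Infinite.exists_subset_card_eq hinf k₀
        exact hbig x y hyx hind O hO hOc
      refine ⟨hfin, ?_⟩
      by_contra! hlt
      obtain ⟨O, hO, hOc⟩ := Set.exists_subset_card_eq hlt.le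
      have hOf : O.Finite := hfin.subset hO
      refine hbig x y hyx hind hOf.toFinset (by simpa using hO) ?_
      rw [← hOc, ncard_eq_toFinset_card O hOf]
    let N : Set ℕ := {m | ∃ x y : X, y ≠ x ∧ Indist 𝔅 y x ∧ (MulAction.orbit G x).ncard = m}
    have hNb : BddAbove N := by
      refine ⟨k₀, ?_⟩
      rintro _ ⟨x, y, hyx, hind, rfl⟩
      exact (hbdd x y hyx hind).2
    have hNne : N.Nonempty := by
      obtain ⟨y, x, hyx, hind⟩ := hns
      exact ⟨_, x, y, hyx, hind, rfl⟩
    obtain ⟨x, y, hyx, hind, hm⟩ := Nat.sSup_mem hNne hNb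
    set m : ℕ := (MulAction.orbit G x).ncard
    obtain ⟨k, hk⟩ := exists_nat_gt (2 * Real.log ((m + 1 : ℕ) : ℝ) / ε)
    -- Infiniteness of `G` allows `K` to be so large that `log (m + 1)` per translate costs at most
    -- `ε`, the Følner factor 2 included.
    obtain ⟨K, hKc⟩ := Infinite.exists_subset_card_eq G (k + 1)
    have hKn : K.Nonempty := by rw [← Finset.card_pos]; omega
    have hMK : 2 * Real.log ((m + 1 : ℕ) : ℝ) ≤ ε * K.card := by
      rw [div_lt_iff₀ hε] at hk
      rw [hKc]
      push_cast at hk ⊢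
      nlinarith
    have hL : ((K : Set G)⁻¹ * (K : Set G)).Finite := K.finite_toSet.inv.mul K.finite_toSet
    obtain ⟨A, hA, hxA, hyA, hfew⟩ := exists_isClopen_few_visits hbas hcont hyx
      (hbdd x y hyx hind).1 (fun y' z' hne hyz => ⟨(hbdd z' y' hne hyz).1, by
        change _ ≤ m
        rw [hm]
        exact le_csSup hNb ⟨z', y', hne, hyz, rfl⟩⟩) hL
    refine ⟨A, hA, fun hA𝔅 => hyA ((hind A hA𝔅).2 hxA), ?_⟩
    -- Visit patterns are locally constant, so by compactness the bound for classes of `𝔅` already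
    -- holds for classes of a finite subfamily.
    obtain ⟨ℱ, hℱ𝔅, hℱ⟩ := exists_finite_subfamily h𝔅
      (fun z => {y | visits A ((K : Set G)⁻¹ * (K : Set G)) y ∈
        visits A ((K : Set G)⁻¹ * (K : Set G)) '' {y' | Indist 𝔅 z y'}})
      (fun z => isOpen_iff_mem_nhds.2 fun y' hy' => by
        filter_upwards [eventually_visits_eq hcont hA hL y'] with y'' hy''
        rw [hy'']
        exact hy')
      (fun z y' h => ⟨y', h, rfl⟩)
    refine familyEntropy_adjoin_le hF hε.le
      (exists_eventually_ncard_visits_le hF hinv hKn hMK hℱ𝔅 fun z => ?_)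
    obtain ⟨z', hz'⟩ := hℱ z
    refine le_trans (ncard_le_ncard ?_ ((finite_range_visits A hL).subset
      (image_subset_range _ _))) (hfew z')
    rintro _ ⟨y', hy', rfl⟩
    exact hz' y' hy'

end SmallStep

/-! ### Factors realizing invariant families. -/

section Quotients

variable {G : Type w} [Group G] {X : Type u} [TopologicalSpace X] [MulAction G X]
  {Y : Type v} [TopologicalSpace Y] [MulAction G Y]

/-- Having the same memberships in the sets of a family, as a setoid. -/
def indistSetoid (𝔅 : Set (Set X)) : Setoid X where
  r := Indist 𝔅
  iseqv := ⟨fun _ _ _ => Iff.rfl, Indist.symm, Indist.trans⟩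

theorem indist_pullback_iff {Ω : Type*} [T1Space Y]
    (hbas : TopologicalSpace.IsTopologicalBasis {s : Set Y | IsClopen s}) (q : Ω → Y) (x y : Ω) :
    q x = q y ↔ Indist ((fun B : Set Y => q ⁻¹' B) '' {B | IsClopen B}) x y := by
  constructor
  · rintro h _ ⟨B, _, rfl⟩
    simp [h]
  · intro h
    by_contra hne
    obtain ⟨B, hB, hxB, hBsub⟩ := hbas.exists_subset_of_mem_open
      (show q x ∈ ({q y}ᶜ : Set Y) from hne) isOpen_compl_singleton
    exact hBsub ((h _ ⟨B, hB, rfl⟩).1 hxB) rfl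

theorem IsZeroDimSystem.topEntropy_eq_familyEntropy_pullback [CompactSpace X]
    (hY : IsZeroDimSystem G Y) {q : X → Y} (hq : IsFactorMap G q) (F : ℕ → Finset G) :
    topEntropy F Y = familyEntropy F ((fun B : Set Y => q ⁻¹' B) '' {B | IsClopen B}) := by
  have := hY.metrizable
  refine topEntropy_eq_familyEntropy hq ?_ (indist_pullback_iff hY.clopen_basis q) F
  rintro _ ⟨B, hB, rfl⟩
  exact hB.preimage hq.continuous

/-- An invariant family of clopen sets is realized by a zero-dimensional factor. -/
theorem IsZeroDimSystem.exists_factor (hX : IsZeroDimSystem G X) {𝔅 : Set (Set X)}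
    (h𝔅 : ∀ B ∈ 𝔅, IsClopen B) (hinv : ∀ g : G, ∀ B ∈ 𝔅, (fun x : X => g • x) ⁻¹' B ∈ 𝔅) :
    ∃ (Z : Type u) (_ : TopologicalSpace Z) (_ : MulAction G Z) (φ : X → Z),
      IsZeroDimSystem G Z ∧ IsFactorMap G φ ∧ ∀ x y, φ x = φ y ↔ Indist 𝔅 x y := by
  have := hX.compact
  have := hX.metrizable
  let s : Setoid X := indistSetoid 𝔅
  let Z := Quotient s
  let q : X → Z := Quotient.mk s
  have hqq : ∀ x y, q x = q y ↔ Indist 𝔅 x y := fun x y => Quotient.eq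
  have hqc : Continuous q := continuous_quotient_mk'
  have hqs : Function.Surjective q := Quotient.mk_surjective
  have hqm : IsQuotientMap q := isQuotientMap_quotient_mk'
  have hmap : ∀ (g : G) (x y : X), Indist 𝔅 x y → Indist 𝔅 (g • x) (g • y) :=
    fun g x y h B hB => h _ (hinv g B hB)
  let act : MulAction G Z :=
    { smul := fun g => Quotient.map (fun x => g • x) (hmap g)
      one_smul := by
        rintro ⟨x⟩
        exact congrArg q (one_smul G x)
      mul_smul := by
        rintro g h ⟨x⟩
        exact congrArg q (mul_smul g h x) }
  have hsep : ∀ a b : Z, a ≠ b → ∃ U : Set Z, IsClopen U ∧ a ∈ U ∧ b ∈ Uᶜ := by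
    intro a b hab
    obtain ⟨x, rfl⟩ := hqs a
    obtain ⟨y, rfl⟩ := hqs b
    have : ¬ Indist 𝔅 x y := fun h => hab ((hqq x y).2 h)
    simp only [Indist, not_forall] at this
    obtain ⟨B, hB, hxy⟩ := this
    -- Members of `𝔅` are saturated, so their images are clopen and separate the points of the
    -- quotient.
    have hpre : q ⁻¹' (q '' B) = B := by
      refine Subset.antisymm ?_ (subset_preimage_image _ _)
      rintro z ⟨z', hz', hzz'⟩
      exact ((hqq _ _).1 hzz' B hB).1 hz'
    have hcl : IsClopen (q '' B) := by
      rw [← hqm.isClopen_preimage, hpre]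
      exact h𝔅 B hB
    have hmem : ∀ z, q z ∈ q '' B ↔ z ∈ B := fun z => by
      rw [← mem_preimage, hpre]
    by_cases hx : x ∈ B
    · have hy : y ∉ B := fun hy => hxy ⟨fun _ => hy, fun _ => hx⟩
      exact ⟨q '' B, hcl, (hmem x).2 hx, fun h => hy ((hmem y).1 h)⟩
    · have hy : y ∈ B := by
        by_contra hy
        exact hxy ⟨fun h => (hx h).elim, fun h => (hy h).elim⟩
      exact ⟨(q '' B)ᶜ, hcl.compl, fun h => hx ((hmem x).1 h), fun h => h ((hmem y).2 hy)⟩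
  have : TotallySeparatedSpace Z := totallySeparatedSpace_iff_exists_isClopen.2
    fun a b hab => hsep a b hab
  have : CompactSpace Z := inferInstanceAs (CompactSpace (Quotient s))
  have : TotallyDisconnectedSpace X :=
    haveI := totallySeparatedSpace_of_t0_of_basis_clopen hX.clopen_basis
    inferInstance
  -- Metrizability of `Z`: its clopen sets inject into the countably many clopen sets of `X`, which
  -- makes the compact totally separated space `Z` second countable.
  have hcX : Countable (TopologicalSpace.Clopens X) :=
    TopologicalSpace.Clopens.countable_iff_secondCountable.2 (by
      let := TopologicalSpace.metrizableSpaceMetric X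
      infer_instance)
  have hcZ : Countable (TopologicalSpace.Clopens Z) := by
    refine Function.Injective.countable
      (f := fun U : TopologicalSpace.Clopens Z =>
        (⟨q ⁻¹' U, U.isClopen.preimage hqc⟩ : TopologicalSpace.Clopens X)) fun U V h => ?_
    have : q ⁻¹' (U : Set Z) = q ⁻¹' (V : Set Z) := congrArg (fun W => W.carrier) h
    exact TopologicalSpace.Clopens.ext (hqs.preimage_injective this)
  have := TopologicalSpace.Clopens.countable_iff_secondCountable.1 hcZ
  refine ⟨Z, inferInstance, act, q, ⟨inferInstance, inferInstance, fun g => ?_, ?_⟩,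
    ⟨hqc, hqs, fun _ _ => rfl⟩, hqq⟩
  · exact hqm.continuous_iff.2 (hqc.comp (hX.continuous_smul g))
  · exact isTopologicalBasis_isClopen

end Quotients

/-! ### Maximal families and the intermediate values. -/

/-- A finite subfamily of the union of a chain lies in a single member of it. -/
theorem familyEntropy_sUnion_le {G : Type w} [Group G] {X : Type u} [MulAction G X]
    (F : ℕ → Finset G) {c : Set (Set (Set X))} (hc : IsChain (· ⊆ ·) c) (hne : c.Nonempty)
    {r : EReal} (h : ∀ 𝔅 ∈ c, familyEntropy F 𝔅 ≤ r) : familyEntropy F (⋃₀ c) ≤ r := by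
  refine iSup₂_le fun ℱ hℱ => ?_
  obtain ⟨𝔅, h𝔅, hsub⟩ :=
    hc.directedOn.exists_mem_subset_of_finite_of_subset_sUnion hne ℱ.finite_toSet hℱ
  exact (le_iSup₂_of_le ℱ hsub le_rfl).trans (h 𝔅 h𝔅)

theorem exists_pos_add_le_of_lt {a r : EReal} (ha : 0 ≤ a) (h : a < r) :
    ∃ ε : ℝ, 0 < ε ∧ a + (ε : EReal) ≤ r := by
  obtain ⟨b, hab, hbr⟩ := EReal.lt_iff_exists_real_btwn.1 h
  lift a to ℝ using ⟨(hab.trans (EReal.coe_lt_top b)).ne, (lt_of_lt_of_le (by simp) ha).ne'⟩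
  refine ⟨b - a, sub_pos.2 (by exact_mod_cast hab), ?_⟩
  rw [← EReal.coe_add, add_sub_cancel]
  exact hbr.le

/-- Every value of the entropy between that of an invariant family of clopen sets and that of the
system is the entropy of some larger invariant family. -/
theorem IsZeroDimSystem.exists_family_familyEntropy_eq {G : Type w} [Group G] [Infinite G]
    {F : ℕ → Finset G} (hF : IsFolnerSeq F) {X : Type u} [TopologicalSpace X] [MulAction G X]
    (hX : IsZeroDimSystem G X) {𝔅₀ : Set (Set X)} (h𝔅₀ : ∀ B ∈ 𝔅₀, IsClopen B)
    (hinv₀ : ∀ g : G, ∀ B ∈ 𝔅₀, (fun x : X => g • x) ⁻¹' B ∈ 𝔅₀) {r : EReal}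
    (hr₀ : familyEntropy F 𝔅₀ ≤ r) (hr : r ≤ topEntropy F X) :
    ∃ 𝔅, 𝔅₀ ⊆ 𝔅 ∧ (∀ B ∈ 𝔅, IsClopen B) ∧
      (∀ g : G, ∀ B ∈ 𝔅, (fun x : X => g • x) ⁻¹' B ∈ 𝔅) ∧ familyEntropy F 𝔅 = r := by
  have := hX.compact
  have := hX.metrizable
  let 𝒮 : Set (Set (Set X)) := {𝔅 | (∀ B ∈ 𝔅, IsClopen B) ∧
    (∀ g : G, ∀ B ∈ 𝔅, (fun x : X => g • x) ⁻¹' B ∈ 𝔅) ∧ familyEntropy F 𝔅 ≤ r}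
  obtain ⟨𝔅, hsub, hmax⟩ := zorn_subset_nonempty 𝒮 (by
    intro c hc hchain hne
    refine ⟨⋃₀ c, ⟨?_, ?_, familyEntropy_sUnion_le F hchain hne fun 𝔅 h => (hc h).2.2⟩,
      fun 𝔅 h => subset_sUnion_of_mem h⟩
    · rintro B ⟨𝔅, h, hB⟩
      exact (hc h).1 B hB
    · rintro g B ⟨𝔅, h, hB⟩
      exact ⟨𝔅, h, (hc h).2.1 g B hB⟩) 𝔅₀ ⟨h𝔅₀, hinv₀, hr₀⟩
  obtain ⟨h𝔅, hinv, hle⟩ := hmax.prop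
  refine ⟨𝔅, hsub, h𝔅, hinv, hle.antisymm ?_⟩
  by_contra! hlt
  -- A family that separates points has the full entropy of `X`, which is at least `r`.
  have hns : ∃ x y : X, x ≠ y ∧ Indist 𝔅 x y := by
    by_contra! hsep
    have hid : IsFactorMap G (id : X → X) :=
      ⟨continuous_id, Function.surjective_id, fun _ _ => rfl⟩
    have : topEntropy F X = familyEntropy F 𝔅 := by
      refine topEntropy_eq_familyEntropy hid h𝔅 (fun x y => ⟨?_, fun h => ?_⟩) F
      · rintro h B _
        rw [show x = y from h]
      · by_contra hne
        exact hsep x y hne h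
    exact absurd (hr.trans this.le) (not_le.2 hlt)
  obtain ⟨ε, hε, hεr⟩ := exists_pos_add_le_of_lt (familyEntropy_nonneg F 𝔅) hlt
  obtain ⟨A, hA, hA𝔅, hAε⟩ := exists_isClopen_familyEntropy_adjoin_le hX.clopen_basis
    hX.continuous_smul hF h𝔅 hinv hns hε
  have hmem : 𝔅 ∪ range (fun g : G => (fun x : X => g • x) ⁻¹' A) ∈ 𝒮 := by
    refine ⟨?_, ?_, hAε.trans hεr⟩
    · rintro B (hB | ⟨g, rfl⟩)
      · exact h𝔅 B hB
      · exact hA.preimage (hX.continuous_smul g)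
    · rintro g B (hB | ⟨h, rfl⟩)
      · exact Or.inl (hinv g B hB)
      · refine Or.inr ⟨h * g, ?_⟩
        ext x
        simp [mul_smul]
  refine hA𝔅 (hmax.le_of_ge hmem subset_union_left (Or.inr ⟨1, ?_⟩))
  ext x
  simp

theorem theorem1p3 {G : Type w} [Group G] [Countable G] [Infinite G]
    (F : ℕ → Finset G) (hF : IsFolnerSeq F)
    {X : Type u} {Y : Type v} [TopologicalSpace X] [TopologicalSpace Y]
    [MulAction G X] [MulAction G Y]
    (hX : IsZeroDimSystem G X) (hY : IsZeroDimSystem G Y)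
    (π : X → Y) (hπ : IsFactorMap G π) :
    zeroDimIntermediateEntropies F π = Set.Icc (topEntropy F Y) (topEntropy F X) := by
  have := hX.compact
  have := hX.metrizable
  have := hY.metrizable
  have hid : IsFactorMap G (id : X → X) :=
    ⟨continuous_id, Function.surjective_id, fun _ _ => rfl⟩
  ext r
  constructor
  · rintro ⟨Z, _, _, φ, ψ, hZ, hφ, hψ, rfl, rfl⟩
    rw [hY.topEntropy_eq_familyEntropy_pullback hπ, hZ.topEntropy_eq_familyEntropy_pullback hφ,
      hX.topEntropy_eq_familyEntropy_pullback hid]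
    constructor
    · refine familyEntropy_mono F ?_
      rintro _ ⟨B, hB, rfl⟩
      exact ⟨ψ ⁻¹' B, hB.preimage hψ.continuous, rfl⟩
    · refine familyEntropy_mono F ?_
      rintro _ ⟨B, hB, rfl⟩
      exact ⟨φ ⁻¹' B, hB.preimage hφ.continuous, rfl⟩
  · rintro ⟨hr₀, hr⟩
    rw [hY.topEntropy_eq_familyEntropy_pullback hπ] at hr₀
    obtain ⟨𝔅, hsub, h𝔅, hinv, hent⟩ := hX.exists_family_familyEntropy_eq hF
      (𝔅₀ := (fun B : Set Y => π ⁻¹' B) '' {B | IsClopen B})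
      (by rintro _ ⟨B, hB, rfl⟩; exact hB.preimage hπ.continuous)
      (by
        rintro g _ ⟨B, hB, rfl⟩
        refine ⟨(fun y : Y => g • y) ⁻¹' B, hB.preimage (hY.continuous_smul g), ?_⟩
        ext x
        simp [hπ.map_smul]) hr₀ hr
    obtain ⟨Z, tZ, aZ, φ, hZ, hφ, hfib⟩ := hX.exists_factor h𝔅 hinv
    have := hZ.metrizable
    -- The choice of preimage is immaterial: `𝔅` contains the pullbacks of the clopen sets of `Y`,
    -- so `π` is constant on the fibres of `φ`.
    let ψ : Z → Y := fun z => π (Function.surjInv hφ.surjective z)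
    have hψφ : ∀ x, ψ (φ x) = π x := fun x =>
      (indist_pullback_iff hY.clopen_basis π _ _).2
        (((hfib _ _).1 (Function.surjInv_eq hφ.surjective (φ x))).mono hsub)
    have hquot : IsQuotientMap φ :=
      hφ.continuous.isClosedMap.isQuotientMap hφ.continuous hφ.surjective
    refine ⟨Z, tZ, aZ, φ, ψ, hZ, hφ, ⟨?_, ?_, ?_⟩, ?_, ?_⟩
    · refine hquot.continuous_iff.2 ?_
      rw [show ψ ∘ φ = π from funext hψφ]
      exact hπ.continuous
    · intro y
      obtain ⟨x, rfl⟩ := hπ.surjective y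
      exact ⟨φ x, hψφ x⟩
    · intro g z
      obtain ⟨x, rfl⟩ := hφ.surjective z
      rw [← hφ.map_smul, hψφ, hψφ, hπ.map_smul]
    · exact (funext hψφ).symm
    · rw [topEntropy_eq_familyEntropy hφ h𝔅 hfib, hent]
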